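/- Let $q\in\mathbb{C}$ with $|q|<1$. Write $(x;q)_n=\prod_{k=0}^{n-1}(1-xq^k)$, $(x;q)_\infty=\prod_{k=0}^{\infty}(1-xq^k)$, $(x_1,\dots,x_m;q)_n=(x_1;q)_n\cdots(x_m;q)_n$ for $n\in\{0,1,2,\dots\}\cup\{\infty\}$, and $${}_r\phi_s\left(\begin{matrix}a_1,\dots,a_r\\ b_1,\dots,b_s\end{matrix};q,z\right)=\sum_{n=0}^{\infty}\frac{(a_1,\dots,a_r;q)_n}{(q,b_1,\dots,b_s;q)_n}\left((-1)^nq^{n(n-1)/2}\right)^{1+s-r}z^n.$$ **(A)** For all nonzero $a,b\in\mathbb{C}$ with $\max\{|aq^2|,|bq^2|,|ab|\}<1$, the series below converge and $$\frac{(q^2,ab;q^2)_\infty}{(aq^2,bq^2;q^2)_\infty}\,{}_3\phi_2\left(\begin{matrix}q^2/a,\,q^2/b,\,-1\\ q,\,-q^2\end{matrix};q^2,ab\right)=\sum_{n=0}^{\infty}\sum_{j=-n}^{n}\frac{(1-q^{4n+2})(q^2/a,q^2/b;q^2)_n(ab)^n}{(aq^2,bq^2;q^2)_n}\,q^{n(n-1)+j^2}.$$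 The identity also holds when $a=0$ or $b=0$ (same inequality), if in every term of both sides $(q^2/a;q^2)_n\,a^n$ and $(q^2/b;q^2)_n\,b^n$ are read as $\prod_{k=0}^{n-1}(a-q^{2k+2})$ and $\prod_{k=0}^{n-1}(b-q^{2k+2})$. **(B)** In particular, the following identities hold, all series being convergent: $$\sum_{n=1}^{\infty}\frac{q^n}{1+q^{2n}}=\sum_{n=1}^{\infty}\sum_{j=-n+1}^{n}q^{n^2+j^2},$$ $$\sum_{n=1}^{\infty}\frac{q^n(q;q^2)_n}{(1+q^{2n})(-q;q^2)_n}=\sum_{n=0}^{\infty}\sum_{j=-n+1}^{n}(-1)^jq^{n^2+j^2}\quad\text{(Wang--Yee)},$$ $$\sum_{n=0}^{\infty}\frac{(-1;q^2)_nq^n}{(q^2;q^2)_n}=\frac{(-q;q)_\infty}{(q;q)_\infty}\sum_{n=0}^{\infty}\sum_{j=-n}^{n}(-1)^j(1-q^{2n+1})q^{n^2+j^2},$$ $$\sum_{n=0}^{\infty}\frac{(-1;q)_{2n}q^n}{(q;q)_{2n}}=\frac{(-q;q)_\infty}{(q;q)_\infty}\sum_{n=0}^{\infty}\sum_{j=-n}^{n}(1-q^{2n+1})q^{n^2+j^2}.$$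 -/

import Mathlib

/-- The finite `q`-shifted factorial `(a; q)_n = ∏_{k=0}^{n-1} (1 - a q^k)`. -/
def qPoch (a q : ℂ) (n : ℕ) : ℂ := ∏ k ∈ Finset.range n, (1 - a * q ^ k)

/-- The infinite `q`-shifted factorial `(a; q)_∞ = ∏_{k=0}^∞ (1 - a q^k)`. -/
noncomputable def qPochInf (a q : ℂ) : ℂ := ∏' k : ℕ, (1 - a * q ^ k)

/-- `(a₁, …, a_m; q)_n = (a₁; q)_n ⋯ (a_m; q)_n`. -/
def qPochs (as : List ℂ) (q : ℂ) (n : ℕ) : ℂ := (as.map fun a => qPoch a q n).prod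

/-- `(a₁, …, a_m; q)_∞ = (a₁; q)_∞ ⋯ (a_m; q)_∞`. -/
noncomputable def qPochsInf (as : List ℂ) (q : ℂ) : ℂ := (as.map fun a => qPochInf a q).prod

/-- The `n`-th term of the basic hypergeometric series `ᵣφₛ(as; bs; q, z)`, where `r` and `s` are
the lengths of the lists `as` and `bs`. -/
noncomputable def basicHypergeometricTerm (as bs : List ℂ) (q z : ℂ) (n : ℕ) : ℂ :=
  qPochs as q n / qPochs (q :: bs) q n *
    ((-1) ^ n * q ^ (n * (n - 1) / 2)) ^ (1 + (bs.length : ℤ) - (as.length : ℤ)) * z ^ n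

/-- The basic hypergeometric series `ᵣφₛ(as; bs; q, z)`. -/
noncomputable def basicHypergeometric (as bs : List ℂ) (q z : ℂ) : ℂ :=
  ∑' n : ℕ, basicHypergeometricTerm as bs q z n

/-- The polynomial `∏_{k=0}^{n-1} (a - q^{2k+2})`. It equals `(q²/a; q²)_n aⁿ` for `a ≠ 0`, and is
the limit of that expression as `a → 0` for `a = 0`. -/
def shiftedProd (a q : ℂ) (n : ℕ) : ℂ := ∏ k ∈ Finset.range n, (a - q ^ (2 * k + 2))

theorem shiftedProd_eq (a q : ℂ) (ha : a ≠ 0) (n : ℕ) :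
    shiftedProd a q n = qPoch (q ^ 2 / a) (q ^ 2) n * a ^ n := by
  unfold shiftedProd qPoch
  rw [← Finset.card_range n, ← Finset.prod_const, Finset.card_range, ← Finset.prod_mul_distrib]
  refine Finset.prod_congr rfl fun k _ => ?_
  field_simp
  ring

/-!
The two-parameter identity is an instance of Bailey's lemma with base `q²`. The sequences
`β_n = (-1; q²)_n / (q², q, -q²; q²)_n` and
`α_r = (1 - q^{4r+2}) q^{r(r-1)} ∑_{|j| ≤ r} q^{j²}` satisfy
`β_n = ∑_{r ≤ n} α_r / ((q²; q²)_{n-r} (q²; q²)_{n+r+1})` (`thetaBeta_eq_sum`). Substituting this into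
`∑_n (q²/a, q²/b; q²)_n (ab)ⁿ β_n` and exchanging the summations leaves, for each `r`, a
`₂φ₁` series that the `q`-Gauss sum (`hasSum_qGaussTerm`) evaluates.

For the Bailey pair, the explicit inverse of the transform is used. Consecutive values
`E_r = thetaTransform q r` of the inverse transform of `β` are related by
`E_{r+1} = q^{2r} E_r + 2 q^{(r+1)(2r+1)}`, by the `q`-Chu–Vandermonde sum, whence
`E_r = q^{r(r-1)} ∑_{|j| ≤ r} q^{j²}`; that the transform inverts is the telescoping sum
`sum_altWeight_orthogonality`.

The `q`-Gauss sum follows from a contiguous relation between the parameters `a` and `a p`: iterated,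
it expresses the sum at `a` through the one at `0`, and the latter is found from the case `a = u`, in
which the series reduces to its first term. The products `(u/a; p)_n aⁿ` are written throughout as
the polynomials `∏_{k<n} (a - u p^k)`, which covers `a = 0` and `b = 0`.

The four special cases apply the identity at `p = ± q` with `(a, b) = (1, q)` and `(a, b) = (-1, -q)`:
since `p² = q²`, only the theta sum and the factor `(p; q²)_n` of `β_n` see the sign of `p`.
-/

open Finset.HasAntidiagonal (antidiagonal mem_antidiagonal)

open Filter Topology

/-! ### Finite `q`-shifted factorials -/

theorem qPoch_zero (a p : ℂ) : qPoch a p 0 = 1 := by simp [qPoch]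

theorem qPoch_succ (a p : ℂ) (n : ℕ) : qPoch a p (n + 1) = qPoch a p n * (1 - a * p ^ n) :=
  Finset.prod_range_succ _ _

theorem qPoch_add (a p : ℂ) (m n : ℕ) :
    qPoch a p (m + n) = qPoch a p m * qPoch (a * p ^ m) p n := by
  simp only [qPoch, Finset.prod_range_add, pow_add, mul_assoc]

theorem qPoch_succ' (a p : ℂ) (n : ℕ) :
    qPoch a p (n + 1) = (1 - a) * qPoch (a * p) p n := by
  rw [add_comm, qPoch_add]; simp [qPoch]

theorem one_sub_mul_pow_ne_zero {a p : ℂ} (ha : ‖a‖ < 1) (hp : ‖p‖ < 1) (k : ℕ) :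
    1 - a * p ^ k ≠ 0 := by
  intro h
  have h1 : ‖a * p ^ k‖ = 1 := by rw [← sub_eq_zero.1 h, norm_one]
  rw [norm_mul, norm_pow] at h1
  have := mul_le_of_le_one_right (norm_nonneg a) (pow_le_one₀ (n := k) (norm_nonneg p) hp.le)
  linarith

theorem qPoch_ne_zero {a p : ℂ} (ha : ‖a‖ < 1) (hp : ‖p‖ < 1) (n : ℕ) : qPoch a p n ≠ 0 :=
  Finset.prod_ne_zero_iff.2 fun k _ => one_sub_mul_pow_ne_zero ha hp k

/-- `(a; q)_{2n}` splits into its factors with even and with odd index. -/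
theorem qPoch_two_mul (a q : ℂ) (n : ℕ) :
    qPoch a q (2 * n) = qPoch a (q ^ 2) n * qPoch (a * q) (q ^ 2) n := by
  induction n with
  | zero => simp [qPoch]
  | succ n ih =>
    rw [show 2 * (n + 1) = 2 * n + 1 + 1 by ring, qPoch_succ, qPoch_succ, ih, qPoch_succ,
      qPoch_succ]
    ring

/-! ### The `q`-Chu–Vandermonde sum -/

/-- The weight `(-1)^i p^{i(i-1)/2} / (p; p)_i`, written as a product so that no half-integer
exponent has to be handled. -/
noncomputable def altWeight (p : ℂ) (i : ℕ) : ℂ :=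
  ∏ k ∈ Finset.range i, -p ^ k / (1 - p ^ (k + 1))

theorem altWeight_zero (p : ℂ) : altWeight p 0 = 1 := by simp [altWeight]

theorem one_sub_pow_succ_ne_zero {p : ℂ} (hp : ‖p‖ < 1) (i : ℕ) : 1 - p ^ (i + 1) ≠ 0 := by
  have := one_sub_mul_pow_ne_zero hp hp i
  rwa [← pow_succ'] at this

theorem altWeight_succ {p : ℂ} (hp : ‖p‖ < 1) (i : ℕ) :
    altWeight p (i + 1) * (1 - p ^ (i + 1)) = -(p ^ i * altWeight p i) := by
  rw [altWeight, Finset.prod_range_succ, ← altWeight, mul_assoc,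
    div_mul_cancel₀ _ (one_sub_pow_succ_ne_zero hp i)]
  ring

/-- A form of the `q`-Pascal rule: the alternating `q`-binomial sum of order `N + 1` of a sequence
is the one of order `N` of its differences. -/
theorem sum_altWeight_succ {p : ℂ} (hp : ‖p‖ < 1) (w : ℕ → ℂ) (N : ℕ) :
    (1 - p ^ (N + 1)) * ∑ x ∈ antidiagonal (N + 1),
        altWeight p x.1 * (w x.2 / qPoch p p x.2) =
      ∑ x ∈ antidiagonal N,
        p ^ x.1 * altWeight p x.1 * ((w (x.2 + 1) - w x.2) / qPoch p p x.2) := by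
  have key : (1 - p ^ (N + 1)) * ∑ x ∈ antidiagonal (N + 1),
        altWeight p x.1 * (w x.2 / qPoch p p x.2) =
      ∑ x ∈ antidiagonal (N + 1),
        p ^ x.1 * altWeight p x.1 * ((1 - p ^ x.2) * w x.2 / qPoch p p x.2) +
      ∑ x ∈ antidiagonal (N + 1),
        (altWeight p x.1 * (1 - p ^ x.1)) * (w x.2 / qPoch p p x.2) := by
    rw [Finset.mul_sum, ← Finset.sum_add_distrib]
    refine Finset.sum_congr rfl fun x hx => ?_
    rw [← mem_antidiagonal.1 hx, pow_add]
    ring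
  rw [key, Finset.Nat.sum_antidiagonal_succ', Finset.Nat.sum_antidiagonal_succ]
  simp only [pow_zero, sub_self, zero_mul, zero_div, mul_zero, zero_add]
  rw [← Finset.sum_add_distrib]
  refine Finset.sum_congr rfl fun x _ => ?_
  rw [altWeight_succ hp, qPoch_succ, ← pow_succ', mul_comm (1 - p ^ (x.2 + 1)),
    mul_div_mul_right _ _ (one_sub_pow_succ_ne_zero hp x.2)]
  ring

/-- The terminating `q`-Chu–Vandermonde sum. One application of the `q`-Pascal rule lowers `N` by
one and replaces `c` by `c p`. -/
theorem qChuVandermonde {p : ℂ} (hp : ‖p‖ < 1) (b : ℂ) (N : ℕ) : ∀ {c : ℂ}, ‖c‖ < 1 →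
    ∑ x ∈ antidiagonal N,
        altWeight p x.1 * (qPoch b p x.2 / qPoch c p x.2 / qPoch p p x.2) =
      (∏ k ∈ Finset.range N, p ^ k * (c * p ^ k - b)) / (qPoch c p N * qPoch p p N) := by
  induction N with
  | zero => intro c _; simp [altWeight, qPoch]
  | succ N ih =>
    intro c hc
    have hcp : ‖c * p‖ < 1 := by
      rw [norm_mul]
      exact mul_lt_one_of_nonneg_of_lt_one_left (norm_nonneg c) hc hp.le
    have hN := one_sub_pow_succ_ne_zero hp N
    have hc1 : 1 - c ≠ 0 := by simpa using one_sub_mul_pow_ne_zero hc hp 0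
    refine mul_left_cancel₀ hN ?_
    rw [sum_altWeight_succ hp (fun j => qPoch b p j / qPoch c p j)]
    have step : ∀ x ∈ antidiagonal N,
        p ^ x.1 * altWeight p x.1 * ((qPoch b p (x.2 + 1) / qPoch c p (x.2 + 1) -
          qPoch b p x.2 / qPoch c p x.2) / qPoch p p x.2) =
        p ^ N * (c - b) / (1 - c) * (altWeight p x.1 *
          (qPoch b p x.2 / qPoch (c * p) p x.2 / qPoch p p x.2)) := by
      intro x hx
      have h1 := qPoch_ne_zero hc hp x.2
      have h2 := qPoch_ne_zero hcp hp x.2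
      have h3 := qPoch_ne_zero hp hp x.2
      have h4 := one_sub_mul_pow_ne_zero hc hp x.2
      have h5 : qPoch c p x.2 * (1 - c * p ^ x.2) = (1 - c) * qPoch (c * p) p x.2 := by
        rw [← qPoch_succ, qPoch_succ']
      rw [← mem_antidiagonal.1 hx, pow_add, qPoch_succ, qPoch_succ]
      have h6 : qPoch (c * p) p x.2 = qPoch c p x.2 * (1 - c * p ^ x.2) / (1 - c) := by
        rw [h5]; field_simp
      rw [h6]
      have h7 : 1 - p ^ x.2 * c ≠ 0 := by rwa [mul_comm]
      field_simp
      ring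
    rw [Finset.sum_congr rfl step, ← Finset.mul_sum, ih hcp, Finset.prod_range_succ',
      qPoch_succ' c, qPoch_succ p]
    have h2 := qPoch_ne_zero hcp hp N
    have h3 := qPoch_ne_zero hp hp N
    have h4 : ∏ k ∈ Finset.range N, p ^ (k + 1) * (c * p ^ (k + 1) - b) =
        p ^ N * ∏ k ∈ Finset.range N, p ^ k * (c * p * p ^ k - b) := by
      rw [← Finset.card_range N, ← Finset.prod_const, Finset.card_range,
        ← Finset.prod_mul_distrib]
      exact Finset.prod_congr rfl fun k _ => by ring
    rw [h4, ← pow_succ']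
    generalize ∏ k ∈ Finset.range N, p ^ k * (c * p * p ^ k - b) = P
    field_simp

/-! ### Symmetric partial theta sums -/

theorem sum_Icc_natAbs_succ (f : ℕ → ℂ) (n : ℕ) :
    ∑ j ∈ Finset.Icc (-((n + 1 : ℕ) : ℤ)) ((n + 1 : ℕ) : ℤ), f j.natAbs =
      ∑ j ∈ Finset.Icc (-(n : ℤ)) (n : ℤ), f j.natAbs + 2 * f (n + 1) := by
  have h : Finset.Icc (-((n + 1 : ℕ) : ℤ)) ((n + 1 : ℕ) : ℤ) =
      insert (-((n + 1 : ℕ) : ℤ)) (insert ((n + 1 : ℕ) : ℤ) (Finset.Icc (-(n : ℤ)) (n : ℤ))) := by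
    ext j; simp only [Finset.mem_insert, Finset.mem_Icc]; omega
  rw [h, Finset.sum_insert, Finset.sum_insert, Int.natAbs_neg, Int.natAbs_natCast]
  · ring
  · simp only [Finset.mem_Icc]; omega
  · simp only [Finset.mem_insert, Finset.mem_Icc]; omega

/-- The interval `-n ≤ j ≤ n + 1` is the symmetric one of radius `n` with one end point added. -/
theorem sum_Icc_natAbs_succ_half (f : ℕ → ℂ) (n : ℕ) :
    ∑ j ∈ Finset.Icc (-((n : ℤ) + 1) + 1) ((n : ℤ) + 1), f j.natAbs =
      ∑ j ∈ Finset.Icc (-(n : ℤ)) (n : ℤ), f j.natAbs + f (n + 1) := by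
  have h : Finset.Icc (-((n : ℤ) + 1) + 1) ((n : ℤ) + 1) =
      insert ((n + 1 : ℕ) : ℤ) (Finset.Icc (-(n : ℤ)) (n : ℤ)) := by
    ext j; simp only [Finset.mem_insert, Finset.mem_Icc]; omega
  rw [h, Finset.sum_insert, Int.natAbs_natCast, add_comm]
  simp only [Finset.mem_Icc]; omega

/-! ### The Bailey pair -/

/-- The sequence `β_n = (-1; q²)_n / (q², q, -q²; q²)_n`. -/
noncomputable def thetaBeta (q : ℂ) (n : ℕ) : ℂ :=
  qPoch (-1) (q ^ 2) n / (qPoch (q ^ 2) (q ^ 2) n * qPoch q (q ^ 2) n * qPoch (-q ^ 2) (q ^ 2) n)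

theorem norm_sq_lt_one {q : ℂ} (hq : ‖q‖ < 1) : ‖q ^ 2‖ < 1 := by
  rw [norm_pow]; exact pow_lt_one₀ (norm_nonneg q) hq two_ne_zero

theorem norm_neg_sq_lt_one {q : ℂ} (hq : ‖q‖ < 1) : ‖-q ^ 2‖ < 1 := by
  rw [norm_neg]; exact norm_sq_lt_one hq

theorem one_add_pow_ne_zero {q : ℂ} (hq : ‖q‖ < 1) (n : ℕ) : 1 + (q ^ 2) ^ (n + 1) ≠ 0 := by
  have := one_sub_mul_pow_ne_zero (norm_neg_sq_lt_one hq) (norm_sq_lt_one hq) n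
  rwa [neg_mul, sub_neg_eq_add, ← pow_succ'] at this

/-- The quotient `(-1; q²)_n / (-q²; q²)_n` telescopes to `2 / (1 + q^{2n})`. -/
theorem qPoch_neg_one_mul (p : ℂ) (n : ℕ) :
    qPoch (-1) p n * (1 + p ^ n) = 2 * qPoch (-p) p n := by
  have h := (qPoch_succ (-1) p n).symm.trans (qPoch_succ' (-1) p n)
  rw [neg_one_mul, neg_one_mul] at h
  linear_combination h

theorem thetaBeta_mul {q : ℂ} (hq : ‖q‖ < 1) (n : ℕ) :
    thetaBeta q n * (1 + (q ^ 2) ^ n) = 2 / (qPoch (q ^ 2) (q ^ 2) n * qPoch q (q ^ 2) n) := by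
  have hQ := norm_sq_lt_one hq
  have h1 := qPoch_ne_zero hQ hQ n
  have h2 := qPoch_ne_zero hq hQ n
  have h3 := qPoch_ne_zero (norm_neg_sq_lt_one hq) hQ n
  rw [thetaBeta, div_mul_eq_mul_div, qPoch_neg_one_mul]
  field_simp

/-- The inverse Bailey transform of `β`, up to the factor `1 - q^{4r+2}`. -/
noncomputable def thetaTransform (q : ℂ) (r : ℕ) : ℂ :=
  ∑ x ∈ antidiagonal r,
    altWeight (q ^ 2) x.1 * (qPoch (q ^ 2) (q ^ 2) (x.1 + 2 * x.2) * thetaBeta q x.2)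

/-- Combining neighbouring transforms produces the factor `1 + q^{2j}`, which cancels the
`(-1; q²)_j / (-q²; q²)_j` in `β_j` and leaves a `q`-Chu–Vandermonde sum. -/
theorem thetaTransform_succ {q : ℂ} (hq : ‖q‖ < 1) (r : ℕ) :
    thetaTransform q (r + 1) =
      (q ^ 2) ^ r * thetaTransform q r + 2 * q ^ ((r + 1) * (2 * r + 1)) := by
  have hQ := norm_sq_lt_one hq
  -- the recurrence of the weights turns a sum over `s + j = r` into one over `s + j = r + 1`
  have shift : (q ^ 2) ^ r * thetaTransform q r =
      -∑ x ∈ antidiagonal (r + 1), altWeight (q ^ 2) x.1 * (1 - (q ^ 2) ^ x.1) *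
        ((q ^ 2) ^ x.2 * qPoch (q ^ 2) (q ^ 2) (r + x.2) * thetaBeta q x.2) := by
    rw [Finset.Nat.sum_antidiagonal_succ, thetaTransform, Finset.mul_sum]
    simp only [pow_zero, sub_self, mul_zero, zero_mul, zero_add]
    rw [← Finset.sum_neg_distrib]
    refine Finset.sum_congr rfl fun x hx => ?_
    rw [altWeight_succ hQ, ← mem_antidiagonal.1 hx, pow_add,
      show x.1 + x.2 + x.2 = x.1 + 2 * x.2 by ring]
    ring
  have hV := qChuVandermonde hQ ((q ^ 2) ^ (r + 1)) (r + 1) hq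
  have hprod : ∏ k ∈ Finset.range (r + 1), (q ^ 2) ^ k * (q * (q ^ 2) ^ k - (q ^ 2) ^ (r + 1)) =
      q ^ ((r + 1) * (2 * r + 1)) * qPoch q (q ^ 2) (r + 1) := by
    -- `q^{2k+1} - q^{2r+2} = q^{2k+1} (1 - q^{2(r-k)+1})`, so the second factors are `(q; q²)_{r+1}`
    -- in reverse order
    have h1 : ∏ k ∈ Finset.range (r + 1), (q ^ 2) ^ k * (q * (q ^ 2) ^ k - (q ^ 2) ^ (r + 1)) =
        (∏ k ∈ Finset.range (r + 1), q ^ (4 * k + 1)) *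
          ∏ k ∈ Finset.range (r + 1), (1 - q * (q ^ 2) ^ (r + 1 - 1 - k)) := by
      rw [← Finset.prod_mul_distrib]
      refine Finset.prod_congr rfl fun k hk => ?_
      obtain ⟨d, hd⟩ := Nat.exists_eq_add_of_le (Nat.lt_succ_iff.1 (Finset.mem_range.1 hk))
      rw [show r + 1 - 1 - k = d by omega, hd]
      ring
    rw [h1, Finset.prod_range_reflect (fun k => 1 - q * (q ^ 2) ^ k), ← qPoch,
      Finset.prod_pow_eq_pow_sum]
    congr 2
    clear h1 shift hV
    induction r with
    | zero => simp
    | succ r ih => rw [Finset.sum_range_succ, ih]; ring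
  rw [hprod, mul_comm (qPoch q _ _), mul_div_mul_right _ _ (qPoch_ne_zero hq hQ _),
    eq_div_iff (qPoch_ne_zero hQ hQ _)] at hV
  rw [← hV, shift, ← sub_eq_iff_eq_add', sub_neg_eq_add, thetaTransform,
    ← Finset.sum_add_distrib, Finset.sum_mul, Finset.mul_sum]
  refine Finset.sum_congr rfl fun x hx => ?_
  have hx' := mem_antidiagonal.1 hx
  have hb := thetaBeta_mul hq x.2
  have h1 := qPoch_ne_zero hQ hQ x.2
  have h2 := qPoch_ne_zero hq hQ x.2
  have e1 : qPoch (q ^ 2) (q ^ 2) (x.1 + 2 * x.2) =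
      qPoch (q ^ 2) (q ^ 2) (r + x.2) * (1 - (q ^ 2) ^ (r + 1) * (q ^ 2) ^ x.2) := by
    rw [show x.1 + 2 * x.2 = r + x.2 + 1 by omega, qPoch_succ]
    ring
  have e2 : qPoch (q ^ 2) (q ^ 2) (r + x.2) =
      qPoch (q ^ 2) (q ^ 2) r * qPoch ((q ^ 2) ^ (r + 1)) (q ^ 2) x.2 := by
    rw [qPoch_add, ← pow_succ']
  have e3 : (q ^ 2) ^ (r + 1) = (q ^ 2) ^ x.1 * (q ^ 2) ^ x.2 := by rw [← hx', pow_add]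
  have e4 : qPoch (q ^ 2) (q ^ 2) (r + 1) =
      qPoch (q ^ 2) (q ^ 2) r * (1 - (q ^ 2) ^ (r + 1)) := by
    rw [qPoch_succ, ← pow_succ']
  have hb' : qPoch ((q ^ 2) ^ (r + 1)) (q ^ 2) x.2 / qPoch q (q ^ 2) x.2 /
      qPoch (q ^ 2) (q ^ 2) x.2 * 2 =
      qPoch ((q ^ 2) ^ (r + 1)) (q ^ 2) x.2 * (thetaBeta q x.2 * (1 + (q ^ 2) ^ x.2)) := by
    rw [hb]; field_simp
  rw [e1, e2, e4]
  linear_combination (-(altWeight (q ^ 2) x.1 * (qPoch (q ^ 2) (q ^ 2) r *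
    (1 - (q ^ 2) ^ (r + 1))))) * hb' + altWeight (q ^ 2) x.1 * qPoch (q ^ 2) (q ^ 2) r *
    qPoch ((q ^ 2) ^ (r + 1)) (q ^ 2) x.2 * thetaBeta q x.2 * e3

/-- The transform of `β` is a partial theta sum. -/
theorem thetaTransform_eq {q : ℂ} (hq : ‖q‖ < 1) (r : ℕ) :
    thetaTransform q r =
      q ^ (r * (r - 1)) * ∑ j ∈ Finset.Icc (-(r : ℤ)) (r : ℤ), q ^ j.natAbs ^ 2 := by
  induction r with
  | zero => simp [thetaTransform, thetaBeta, altWeight, qPoch]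
  | succ r ih =>
    rw [thetaTransform_succ hq, ih, sum_Icc_natAbs_succ (fun j => q ^ j ^ 2)]
    have h : (q ^ 2) ^ r * q ^ (r * (r - 1)) = q ^ ((r + 1) * (r + 1 - 1)) := by
      cases r with
      | zero => simp
      | succ r => simp only [Nat.add_sub_cancel]; ring
    rw [← mul_assoc, h, Nat.add_sub_cancel]
    ring

/-- The orthogonality relation behind the inversion of Bailey's transform. -/
theorem sum_altWeight_orthogonality {p : ℂ} (hp : ‖p‖ < 1) (K N : ℕ) :
    ∑ x ∈ antidiagonal N, altWeight p x.1 * (1 - p ^ (K + 1 + 2 * x.1)) * qPoch p p (K + x.1) /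
      (qPoch p p x.2 * qPoch p p (N + K + x.1 + 1)) = if N = 0 then 1 else 0 := by
  have hne := qPoch_ne_zero hp hp
  have hs : ∀ n, qPoch p p (n + 1) = qPoch p p n * (1 - p ^ (n + 1)) := fun n => by
    rw [qPoch_succ, ← pow_succ']
  rcases N with _ | N
  · have h1 := one_sub_pow_succ_ne_zero hp K
    have h2 := hne K
    simp [altWeight_zero, hs, qPoch_zero]
    field_simp
  -- the partial sums have a closed form, whose value at the end cancels the last term
  have tele : ∀ M d, N + 1 = M + d →
      (1 - p ^ (N + 1)) * ∑ s ∈ Finset.range M, altWeight p s * (1 - p ^ (K + 1 + 2 * s)) *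
        qPoch p p (K + s) / (qPoch p p (N + 1 - s) * qPoch p p (N + 1 + K + s + 1)) =
      -(altWeight p M * (1 - p ^ M) * qPoch p p (K + M)) /
        (qPoch p p d * qPoch p p (N + 1 + K + M)) := by
    intro M
    induction M with
    | zero => intro d _; simp
    | succ M ih =>
      intro d hd
      rw [Finset.sum_range_succ, mul_add, ih (d + 1) (by omega), altWeight_succ hp,
        show N + 1 - M = d + 1 by omega, show K + (M + 1) = K + M + 1 by ring,
        show N + 1 + K + (M + 1) = N + 1 + K + M + 1 by ring, hs d, hs (K + M),
        hs (N + 1 + K + M)]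
      have h1 := hne d
      have h2 := hne (N + 1 + K + M)
      have h3 := one_sub_pow_succ_ne_zero hp d
      have h4 := one_sub_pow_succ_ne_zero hp (N + 1 + K + M)
      rw [hd] at h2 h4 ⊢
      field_simp
      ring
  rw [Finset.Nat.sum_antidiagonal_eq_sum_range_succ_mk, Finset.sum_range_succ]
  refine mul_left_cancel₀ (one_sub_pow_succ_ne_zero hp N) ?_
  rw [mul_add, tele (N + 1) 0 rfl]
  simp only [Nat.sub_self, qPoch_zero, Nat.succ_ne_zero, if_false, mul_zero, one_mul]
  rw [hs (N + 1 + K + (N + 1))]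
  have h2 := hne (N + 1 + K + (N + 1))
  have h4 := one_sub_pow_succ_ne_zero hp (N + 1 + K + (N + 1))
  rw [show N + 1 + K + (N + 1) + 1 = K + 1 + 2 * (N + 1) by ring] at h4 ⊢
  field_simp
  ring

/-- The Bailey pair relation `β_n = ∑_r α_r / ((q²; q²)_{n-r} (q²; q²)_{n+r+1})`. -/
theorem thetaBeta_eq_sum {q : ℂ} (hq : ‖q‖ < 1) (n : ℕ) :
    ∑ x ∈ antidiagonal n, (1 - (q ^ 2) ^ (2 * x.1 + 1)) * thetaTransform q x.1 /
      (qPoch (q ^ 2) (q ^ 2) x.2 * qPoch (q ^ 2) (q ^ 2) (x.2 + 2 * x.1 + 1)) = thetaBeta q n := by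
  have hQ := norm_sq_lt_one hq
  have swap : ∑ x ∈ antidiagonal n, (1 - (q ^ 2) ^ (2 * x.1 + 1)) * thetaTransform q x.1 /
      (qPoch (q ^ 2) (q ^ 2) x.2 * qPoch (q ^ 2) (q ^ 2) (x.2 + 2 * x.1 + 1)) =
      ∑ x ∈ antidiagonal n, thetaBeta q x.2 * ∑ y ∈ antidiagonal x.1,
        altWeight (q ^ 2) y.1 * (1 - (q ^ 2) ^ (2 * x.2 + 1 + 2 * y.1)) *
          qPoch (q ^ 2) (q ^ 2) (2 * x.2 + y.1) / (qPoch (q ^ 2) (q ^ 2) y.2 *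
            qPoch (q ^ 2) (q ^ 2) (x.1 + 2 * x.2 + y.1 + 1)) := by
    simp only [thetaTransform, Finset.mul_sum, Finset.sum_div]
    rw [Finset.sum_sigma', Finset.sum_sigma']
    refine Finset.sum_nbij' (fun z => ⟨(z.2.1 + z.1.2, z.2.2), (z.2.1, z.1.2)⟩)
      (fun z => ⟨(z.2.1 + z.1.2, z.2.2), (z.2.1, z.1.2)⟩) ?_ ?_ ?_ ?_ ?_
    · rintro ⟨⟨a, b⟩, c, d⟩ h
      simp only [Finset.mem_sigma, mem_antidiagonal, and_true] at h ⊢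
      have := h.1
      have := h.2
      omega
    · rintro ⟨⟨a, b⟩, c, d⟩ h
      simp only [Finset.mem_sigma, mem_antidiagonal, and_true] at h ⊢
      have := h.1
      have := h.2
      omega
    · rintro ⟨⟨a, b⟩, c, d⟩ h
      simp only [Finset.mem_sigma, mem_antidiagonal] at h
      rw [← h.2]
    · rintro ⟨⟨a, b⟩, c, d⟩ h
      simp only [Finset.mem_sigma, mem_antidiagonal] at h
      rw [← h.2]
    · rintro ⟨⟨a, b⟩, c, d⟩ h
      simp only [Finset.mem_sigma, mem_antidiagonal] at h
      obtain ⟨_, rfl⟩ := h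
      simp only
      rw [show 2 * (c + d) + 1 = 2 * d + 1 + 2 * c by ring, show c + 2 * d = 2 * d + c by ring,
        show b + 2 * (c + d) + 1 = c + b + 2 * d + c + 1 by ring]
      ring
  rw [swap]
  simp only [sum_altWeight_orthogonality hQ]
  rw [Finset.sum_eq_single (0, n)]
  · simp
  · rintro ⟨a, b⟩ h hne
    rw [mem_antidiagonal] at h
    rw [if_neg, mul_zero]
    rintro rfl
    exact hne (by simp at h; simp [h])
  · simp

/-! ### Infinite `q`-shifted factorials -/


theorem summable_norm_neg_mul_pow (a : ℂ) {p : ℂ} (hp : ‖p‖ < 1) :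
    Summable fun k : ℕ => ‖-(a * p ^ k)‖ := by
  simpa [norm_mul, norm_pow] using
    (summable_geometric_of_lt_one (norm_nonneg p) hp).mul_left ‖a‖

theorem tendsto_qPoch (a : ℂ) {p : ℂ} (hp : ‖p‖ < 1) :
    Tendsto (qPoch a p) atTop (𝓝 (qPochInf a p)) := by
  have h := (multipliable_one_add_of_summable
    (summable_norm_neg_mul_pow a hp)).hasProd.tendsto_prod_nat
  simp only [← sub_eq_add_neg] at h
  exact h

theorem qPochInf_ne_zero {a p : ℂ} (ha : ‖a‖ < 1) (hp : ‖p‖ < 1) : qPochInf a p ≠ 0 := by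
  have h := tprod_one_add_ne_zero_of_summable (f := fun k : ℕ => -(a * p ^ k))
    (fun k => by simpa [← sub_eq_add_neg] using one_sub_mul_pow_ne_zero ha hp k)
    (summable_norm_neg_mul_pow a hp)
  simp only [← sub_eq_add_neg] at h
  exact h

theorem qPochInf_eq_mul (a : ℂ) {p : ℂ} (hp : ‖p‖ < 1) (n : ℕ) :
    qPochInf a p = qPoch a p n * qPochInf (a * p ^ n) p := by
  have h := (tendsto_qPoch (a * p ^ n) hp).const_mul (qPoch a p n)
  simp only [← qPoch_add] at h
  refine tendsto_nhds_unique (tendsto_qPoch a hp) ((tendsto_add_atTop_iff_nat n).1 ?_)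
  simpa only [add_comm n] using h

theorem qPochInf_eq_mul_sq (a : ℂ) {q : ℂ} (hq : ‖q‖ < 1) :
    qPochInf a q = qPochInf a (q ^ 2) * qPochInf (a * q) (q ^ 2) := by
  have hQ := norm_sq_lt_one hq
  have h := (tendsto_qPoch a hQ).mul (tendsto_qPoch (a * q) hQ)
  refine tendsto_nhds_unique ((tendsto_qPoch a hq).comp
    (tendsto_id.const_mul_atTop' (by norm_num : 0 < 2))) (h.congr fun n => ?_)
  exact (qPoch_two_mul a q n).symm

theorem exists_norm_inv_qPoch_le {a p : ℂ} (ha : ‖a‖ < 1) (hp : ‖p‖ < 1) :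
    ∃ C : ℝ, 0 ≤ C ∧ ∀ n, ‖(qPoch a p n)⁻¹‖ ≤ C := by
  obtain ⟨C, hC⟩ := (((tendsto_qPoch a hp).inv₀ (qPochInf_ne_zero ha hp)).norm).bddAbove_range
  have h : ∀ n, ‖(qPoch a p n)⁻¹‖ ≤ C := fun n => hC ⟨n, rfl⟩
  exact ⟨C, (norm_nonneg _).trans (h 0), h⟩

/-! ### Geometric bounds for products -/

/-- A product whose factors converge to a limit below `1` decays geometrically. -/
theorem exists_prod_le_geometric {d : ℕ → ℝ} (hd : ∀ k, 0 ≤ d k) {L : ℝ} (hL : L < 1)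
    (h : Tendsto d atTop (𝓝 L)) :
    ∃ C ρ : ℝ, 0 ≤ C ∧ 0 ≤ ρ ∧ ρ < 1 ∧ ∀ m, ∏ k ∈ Finset.range m, d k ≤ C * ρ ^ m := by
  have hL0 : 0 ≤ L := ge_of_tendsto' h hd
  obtain ⟨ρ, hLρ, hρ⟩ := exists_between hL
  have hρ0 : 0 < ρ := hL0.trans_lt hLρ
  obtain ⟨K, hK⟩ := eventually_atTop.1 (h.eventually_lt_const hLρ)
  have hone : ∀ m, 0 ≤ ∏ k ∈ Finset.range m, max 1 (d k / ρ) := fun m =>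
    Finset.prod_nonneg fun _ _ => zero_le_one.trans (le_max_left _ _)
  refine ⟨∏ k ∈ Finset.range K, max 1 (d k / ρ), ρ, hone K, hρ0.le, hρ, fun m => ?_⟩
  have h1 : ∏ k ∈ Finset.range m, d k = (∏ k ∈ Finset.range m, d k / ρ) * ρ ^ m := by
    rw [Finset.prod_div_distrib, Finset.prod_const, Finset.card_range,
      div_mul_cancel₀ _ (pow_ne_zero _ hρ0.ne')]
  rw [h1]
  refine mul_le_mul_of_nonneg_right ?_ (pow_nonneg hρ0.le m)
  calc ∏ k ∈ Finset.range m, d k / ρ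
      ≤ ∏ k ∈ Finset.range m, max 1 (d k / ρ) :=
        Finset.prod_le_prod (fun k _ => div_nonneg (hd k) hρ0.le) fun k _ => le_max_right _ _
    _ ≤ ∏ k ∈ Finset.range (m + K), max 1 (d k / ρ) := by
        rw [Finset.prod_range_add]
        exact le_mul_of_one_le_right (hone m) (Finset.one_le_prod fun _ _ => le_max_left _ _)
    _ = ∏ k ∈ Finset.range K, max 1 (d k / ρ) := by
        rw [add_comm m, Finset.prod_range_add]
        have : ∀ k ∈ Finset.range m, max 1 (d (K + k) / ρ) = 1 := fun k _ =>
          max_eq_left ((div_le_one hρ0).2 (hK _ (Nat.le_add_right K k)).le)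
        rw [Finset.prod_congr rfl this, Finset.prod_const_one, mul_one]

/-- The polynomial `∏_{k<n} (a - u p^k)`, equal to `(u/a; p)_n aⁿ` for `a ≠ 0`. -/
def qShift (u p a : ℂ) (n : ℕ) : ℂ := ∏ k ∈ Finset.range n, (a - u * p ^ k)

theorem qShift_succ (u p a : ℂ) (n : ℕ) :
    qShift u p a (n + 1) = qShift u p a n * (a - u * p ^ n) := Finset.prod_range_succ _ _

theorem qShift_add (u p a : ℂ) (r m : ℕ) :
    qShift u p a (r + m) = qShift u p a r * qShift (u * p ^ r) p a m := by
  simp only [qShift, Finset.prod_range_add, pow_add, mul_assoc]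

theorem qShift_self (u p : ℂ) {n : ℕ} (hn : n ≠ 0) : qShift u p u n = 0 :=
  Finset.prod_eq_zero (Finset.mem_range.2 hn.bot_lt) (by simp)

theorem qShift_mul_succ (u p a : ℂ) (n : ℕ) :
    qShift u p (a * p) (n + 1) = p ^ n * (a * p - u) * qShift u p a n := by
  rw [qShift, Finset.prod_range_succ', qShift]
  have : ∏ k ∈ Finset.range n, (a * p - u * p ^ (k + 1)) =
      p ^ n * ∏ k ∈ Finset.range n, (a - u * p ^ k) := by
    rw [← Finset.card_range n, ← Finset.prod_const, Finset.card_range,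
      ← Finset.prod_mul_distrib]
    exact Finset.prod_congr rfl fun k _ => by ring
  rw [this]; simp; ring

theorem norm_qShift_le (u p : ℂ) {a : ℂ} {A : ℝ} (ha : ‖a‖ ≤ A) (n : ℕ) :
    ‖qShift u p a n‖ ≤ ∏ k ∈ Finset.range n, (A + ‖u‖ * ‖p‖ ^ k) := by
  rw [qShift, norm_prod]
  refine Finset.prod_le_prod (fun _ _ => norm_nonneg _) fun k _ => ?_
  refine (norm_sub_le _ _).trans ?_
  rw [norm_mul, norm_pow]
  gcongr

/-- The bound is uniform in `a'`, as dominated convergence for `a' → 0` requires. -/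
theorem exists_norm_qShift_mul_le (u : ℂ) {p : ℂ} (hp : ‖p‖ < 1) {a b : ℂ} (hab : ‖a * b‖ < 1) :
    ∃ C ρ : ℝ, 0 ≤ C ∧ 0 ≤ ρ ∧ ρ < 1 ∧ ∀ a', ‖a'‖ ≤ ‖a‖ → ∀ m,
      ‖qShift u p a' m * qShift u p b m‖ ≤ C * ρ ^ m := by
  have hpow : Tendsto (fun k : ℕ => ‖u‖ * ‖p‖ ^ k) atTop (𝓝 0) := by
    simpa using (tendsto_pow_atTop_nhds_zero_of_lt_one (norm_nonneg p) hp).const_mul ‖u‖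
  have hlim : Tendsto (fun k : ℕ => (‖a‖ + ‖u‖ * ‖p‖ ^ k) * (‖b‖ + ‖u‖ * ‖p‖ ^ k)) atTop
      (𝓝 ‖a * b‖) := by
    simpa using (hpow.const_add ‖a‖).mul (hpow.const_add ‖b‖)
  obtain ⟨C, ρ, hC, hρ0, hρ, h⟩ := exists_prod_le_geometric (fun k => by positivity) hab hlim
  refine ⟨C, ρ, hC, hρ0, hρ, fun a' ha' m => le_trans ?_ (h m)⟩
  rw [norm_mul, Finset.prod_mul_distrib]
  exact mul_le_mul (norm_qShift_le u p ha' m) (norm_qShift_le u p le_rfl m) (norm_nonneg _)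
    (Finset.prod_nonneg fun _ _ => by positivity)

/-! ### The `q`-Gauss sum -/

/-- The terms of the `q`-Gauss series `₂φ₁(u/a, u/b; u²; p, ab)`, in the form that makes sense for
`a = 0` and `b = 0`. -/
noncomputable def qGaussTerm (u p b a : ℂ) (m : ℕ) : ℂ :=
  qShift u p a m * qShift u p b m / (qPoch p p m * qPoch (u ^ 2) p m)

theorem exists_norm_qGaussTerm_le {u p : ℂ} (hu : ‖u‖ < 1) (hp : ‖p‖ < 1)
    {a b : ℂ} (hab : ‖a * b‖ < 1) :
    ∃ C ρ : ℝ, 0 ≤ ρ ∧ ρ < 1 ∧ ∀ a', ‖a'‖ ≤ ‖a‖ → ∀ m, ‖qGaussTerm u p b a' m‖ ≤ C * ρ ^ m := by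
  obtain ⟨C, ρ, hC, hρ0, hρ, h⟩ := exists_norm_qShift_mul_le u hp hab
  obtain ⟨K₁, hK₁, h₁⟩ := exists_norm_inv_qPoch_le hp hp
  obtain ⟨K₂, hK₂, h₂⟩ := exists_norm_inv_qPoch_le (norm_sq_lt_one hu) hp
  refine ⟨C * (K₁ * K₂), ρ, hρ0, hρ, fun a' ha' m => ?_⟩
  rw [qGaussTerm, div_eq_mul_inv, mul_inv, norm_mul, norm_mul (qPoch p p m)⁻¹, mul_right_comm]
  exact mul_le_mul (h a' ha' m) (mul_le_mul (h₁ m) (h₂ m) (norm_nonneg _) hK₁) (by positivity)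
    (by positivity)

theorem summable_qGaussTerm {u p : ℂ} (hu : ‖u‖ < 1) (hp : ‖p‖ < 1)
    {a b : ℂ} (hab : ‖a * b‖ < 1) : Summable (qGaussTerm u p b a) := by
  obtain ⟨C, ρ, hρ0, hρ, h⟩ := exists_norm_qGaussTerm_le hu hp hab
  exact .of_norm_bounded ((summable_geometric_of_lt_one hρ0 hρ).mul_left C) (h a le_rfl)

theorem norm_mul_pow_mul_lt_one {p : ℂ} (hp : ‖p‖ < 1) {a b : ℂ} (hab : ‖a * b‖ < 1) (n : ℕ) :
    ‖a * p ^ n * b‖ < 1 := by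
  rw [mul_right_comm, norm_mul, norm_pow]
  exact mul_lt_one_of_nonneg_of_lt_one_left (norm_nonneg _) hab
    (pow_le_one₀ (norm_nonneg p) hp.le)

/-- The contiguous relation for the partial sums of the `q`-Gauss series, proved by telescoping. -/
theorem sum_qGaussTerm_contiguous {u p : ℂ} (hu : ‖u‖ < 1) (hp : ‖p‖ < 1)
    (a b : ℂ) (M : ℕ) :
    (1 - a * b) * ∑ m ∈ Finset.range (M + 1), qGaussTerm u p b a m -
      (1 - u * a) * ∑ m ∈ Finset.range (M + 1), qGaussTerm u p b (a * p) m =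
      -a * (b - u * p ^ M) * qGaussTerm u p b a M := by
  induction M with
  | zero => simp [qGaussTerm, qShift, qPoch]; ring
  | succ M ih =>
    rw [Finset.sum_range_succ, Finset.sum_range_succ (fun m => qGaussTerm u p b (a * p) m),
      mul_add, mul_add, add_sub_add_comm, ih]
    have h1 := qPoch_ne_zero hp hp M
    have h2 := qPoch_ne_zero (norm_sq_lt_one hu) hp M
    have h4 := one_sub_mul_pow_ne_zero (norm_sq_lt_one hu) hp M
    have h3 : 1 - p ^ (M + 1) ≠ 0 := one_sub_pow_succ_ne_zero hp M
    simp only [qGaussTerm, qShift_mul_succ]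
    simp only [qShift_succ, qPoch_succ]
    rw [← pow_succ']
    field_simp
    ring

theorem tsum_qGaussTerm_contiguous {u p : ℂ} (hu : ‖u‖ < 1) (hp : ‖p‖ < 1)
    {a b : ℂ} (hab : ‖a * b‖ < 1) :
    (1 - a * b) * ∑' m, qGaussTerm u p b a m =
      (1 - u * a) * ∑' m, qGaussTerm u p b (a * p) m := by
  have hs := summable_qGaussTerm hu hp hab
  have hs' : Summable (qGaussTerm u p b (a * p)) := by
    simpa using summable_qGaussTerm hu hp (norm_mul_pow_mul_lt_one hp hab 1)
  have h1 := ((hs.hasSum.tendsto_sum_nat.const_mul (1 - a * b)).sub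
    (hs'.hasSum.tendsto_sum_nat.const_mul (1 - u * a))).comp (tendsto_add_atTop_nat 1)
  have h2 : Tendsto (fun M : ℕ => -a * (b - u * p ^ M) * qGaussTerm u p b a M) atTop (𝓝 0) := by
    have hpow := (tendsto_pow_atTop_nhds_zero_of_norm_lt_one hp).const_mul u
    simpa using ((hpow.const_sub b).const_mul (-a)).mul hs.tendsto_atTop_zero
  exact sub_eq_zero.1 (tendsto_nhds_unique
    (h1.congr fun M => sum_qGaussTerm_contiguous hu hp a b M) h2)

theorem qPoch_mul_tsum_qGaussTerm {u p : ℂ} (hu : ‖u‖ < 1) (hp : ‖p‖ < 1)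
    {a b : ℂ} (hab : ‖a * b‖ < 1) (n : ℕ) :
    qPoch (a * b) p n * ∑' m, qGaussTerm u p b a m =
      qPoch (u * a) p n * ∑' m, qGaussTerm u p b (a * p ^ n) m := by
  induction n with
  | zero => simp [qPoch]
  | succ n ih =>
    have h := tsum_qGaussTerm_contiguous hu hp (norm_mul_pow_mul_lt_one hp hab n)
    rw [mul_assoc a (p ^ n) p, ← pow_succ] at h
    rw [qPoch_succ, qPoch_succ]
    linear_combination (1 - a * b * p ^ n) * ih + qPoch (u * a) p n * h

/-- Iterating the contiguous relation moves `a` through `a pⁿ` to `0`. -/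
theorem qPochInf_mul_tsum_qGaussTerm {u p : ℂ} (hu : ‖u‖ < 1) (hp : ‖p‖ < 1)
    {a b : ℂ} (hab : ‖a * b‖ < 1) :
    qPochInf (a * b) p * ∑' m, qGaussTerm u p b a m =
      qPochInf (u * a) p * ∑' m, qGaussTerm u p b 0 m := by
  obtain ⟨C, ρ, hρ0, hρ, h⟩ := exists_norm_qGaussTerm_le hu hp hab
  have hcont : Tendsto (fun n : ℕ => ∑' m, qGaussTerm u p b (a * p ^ n) m) atTop
      (𝓝 (∑' m, qGaussTerm u p b 0 m)) := by
    refine tendsto_tsum_of_dominated_convergence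
      ((summable_geometric_of_lt_one hρ0 hρ).mul_left C) (fun m => ?_)
      (Eventually.of_forall fun n m => h _ ?_ m)
    · have hc : Continuous fun a' => qGaussTerm u p b a' m := by
        unfold qGaussTerm qShift
        fun_prop
      refine (hc.tendsto 0).comp ?_
      simpa using (tendsto_pow_atTop_nhds_zero_of_norm_lt_one hp).const_mul a
    · rw [norm_mul, norm_pow]
      exact mul_le_of_le_one_right (norm_nonneg a) (pow_le_one₀ (norm_nonneg p) hp.le)
  exact tendsto_nhds_unique
    (((tendsto_qPoch (a * b) hp).mul_const _).congr fun n => qPoch_mul_tsum_qGaussTerm hu hp hab n)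
    ((tendsto_qPoch (u * a) hp).mul hcont)

/-- The `q`-Gauss sum. The value at `a = 0` comes from the trivial case `a = u`. -/
theorem hasSum_qGaussTerm {u p : ℂ} (hu : ‖u‖ < 1) (hp : ‖p‖ < 1)
    {a b : ℂ} (hab : ‖a * b‖ < 1) (hub : ‖u * b‖ < 1) :
    HasSum (qGaussTerm u p b a)
      (qPochInf (u * a) p * qPochInf (u * b) p / (qPochInf (u ^ 2) p * qPochInf (a * b) p)) := by
  have h1 := qPochInf_mul_tsum_qGaussTerm hu hp hab
  -- for `a = u` only the term with `m = 0` survives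
  have h2 := qPochInf_mul_tsum_qGaussTerm hu hp hub
  have h3 : ∑' m, qGaussTerm u p b u m = 1 := by
    rw [tsum_eq_single 0 fun m hm => by simp [qGaussTerm, qShift_self u p hm]]
    simp [qGaussTerm, qShift, qPoch]
  rw [h3, mul_one, ← sq] at h2
  have e1 := qPochInf_ne_zero hab hp
  have e2 := qPochInf_ne_zero (norm_sq_lt_one hu) hp
  convert (summable_qGaussTerm hu hp hab).hasSum using 1
  rw [div_eq_iff (mul_ne_zero e2 e1)]
  linear_combination (-qPochInf (u ^ 2) p) * h1 + qPochInf (u * a) p * h2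

/-! ### Bailey's lemma for the pair -/

theorem shiftedProd_eq_qShift (a q : ℂ) (n : ℕ) :
    shiftedProd a q n = qShift (q ^ 2) (q ^ 2) a n := by
  refine Finset.prod_congr rfl fun k _ => ?_
  ring

theorem norm_sum_Icc_le {f : ℕ → ℂ} (hf : ∀ j, ‖f j‖ ≤ 1) (n : ℕ) :
    ‖∑ j ∈ Finset.Icc (-(n : ℤ)) (n : ℤ), f j.natAbs‖ ≤ 2 * n + 1 := by
  refine (norm_sum_le_of_le _ fun j _ => hf j.natAbs).trans ?_
  rw [Finset.sum_const, Int.card_Icc, nsmul_eq_mul, mul_one,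
    show ((n : ℤ) + 1 - -(n : ℤ)).toNat = 2 * n + 1 by omega]
  push_cast
  exact le_rfl

theorem norm_pow_le_one {q : ℂ} (hq : ‖q‖ < 1) (n : ℕ) : ‖q ^ n‖ ≤ 1 := by
  rw [norm_pow]; exact pow_le_one₀ (norm_nonneg q) hq.le

/-- The sequence `α_r` of the Bailey pair, without its constant factor `1 / (1 - q²)`. -/
noncomputable def thetaAlpha (q : ℂ) (r : ℕ) : ℂ :=
  (1 - (q ^ 2) ^ (2 * r + 1)) * thetaTransform q r

theorem norm_thetaAlpha_le {q : ℂ} (hq : ‖q‖ < 1) (r : ℕ) :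
    ‖thetaAlpha q r‖ ≤ 2 * (2 * r + 1) := by
  rw [thetaAlpha, thetaTransform_eq hq, norm_mul, norm_mul]
  have h1 : ‖1 - (q ^ 2) ^ (2 * r + 1)‖ ≤ 2 := by
    refine (norm_sub_le _ _).trans ?_
    have := norm_pow_le_one (norm_sq_lt_one hq) (2 * r + 1)
    rw [norm_one]; linarith
  have h2 := norm_sum_Icc_le (f := fun j => q ^ j ^ 2) (fun j => norm_pow_le_one hq _) r
  refine mul_le_mul h1 ?_ (by positivity) zero_le_two
  exact (mul_le_of_le_one_left (norm_nonneg _) (norm_pow_le_one hq _)).trans h2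

/-- The terms of the double series that Bailey's lemma sums in two ways: along `r + m = n` it gives
the `β`-series, along `r` fixed the `α`-series. -/
noncomputable def baileyTerm (q a b : ℂ) (x : ℕ × ℕ) : ℂ :=
  shiftedProd a q (x.1 + x.2) * shiftedProd b q (x.1 + x.2) * (thetaAlpha q x.1 /
    (qPoch (q ^ 2) (q ^ 2) x.2 * qPoch (q ^ 2) (q ^ 2) (x.2 + 2 * x.1 + 1)))

theorem summable_baileyTerm {q : ℂ} (hq : ‖q‖ < 1) {a b : ℂ} (hab : ‖a * b‖ < 1) :
    Summable (baileyTerm q a b) := by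
  have hQ := norm_sq_lt_one hq
  obtain ⟨C, ρ, hC, hρ0, hρ, h⟩ := exists_norm_qShift_mul_le (q ^ 2) hQ hab
  obtain ⟨K, hK, hinv⟩ := exists_norm_inv_qPoch_le hQ hQ
  have hf : Summable fun r : ℕ => C * (2 * (2 * r + 1) * ρ ^ r) * (K * K) := by
    have h1 := summable_pow_mul_geometric_of_norm_lt_one 1
      (show ‖ρ‖ < 1 by rwa [Real.norm_of_nonneg hρ0])
    have h2 := summable_geometric_of_lt_one hρ0 hρ
    refine (((h1.mul_left 4).add (h2.mul_left 2)).mul_left C |>.mul_right (K * K)).congr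
      fun r => ?_
    ring
  refine .of_norm_bounded (hf.mul_of_nonneg (summable_geometric_of_lt_one hρ0 hρ)
    (fun r => ?_) fun m => pow_nonneg hρ0 m) ?_
  · have := pow_nonneg hρ0 r
    simp only [Pi.zero_apply]
    positivity
  rintro ⟨r, m⟩
  have h1 := h a le_rfl (r + m)
  rw [← shiftedProd_eq_qShift, ← shiftedProd_eq_qShift] at h1
  have h2 := norm_thetaAlpha_le hq r
  have h3 := mul_le_mul (hinv m) (hinv (m + 2 * r + 1)) (norm_nonneg _) hK
  rw [baileyTerm, div_eq_mul_inv, mul_inv, norm_mul, norm_mul (thetaAlpha q r),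
    norm_mul (qPoch _ _ _)⁻¹]
  calc _ ≤ C * ρ ^ (r + m) * (2 * (2 * r + 1) * (K * K)) :=
        mul_le_mul h1 (mul_le_mul h2 h3 (by positivity) (by positivity)) (by positivity)
          (mul_nonneg hC (pow_nonneg hρ0 _))
    _ = _ := by rw [pow_add]; ring

theorem hasSum_of_eq {f g : ℕ → ℂ} {s t : ℂ} (h : HasSum f s) (hg : ∀ n, g n = f n)
    (ht : t = s) : HasSum g t := by
  rw [funext hg, ht]; exact h

theorem hasSum_antidiagonal {f : ℕ × ℕ → ℂ} (hf : Summable f) :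
    HasSum (fun n => ∑ x ∈ antidiagonal n, f x) (∑' x, f x) := by
  have h := (Finset.HasAntidiagonal.sigmaAntidiagonalEquivProd (A := ℕ)).hasSum_iff.2 hf.hasSum
  refine hasSum_of_eq (h.sigma fun n => hasSum_fintype _) (fun n => ?_) rfl
  exact (Finset.sum_coe_sort (antidiagonal n) f).symm

theorem hasSum_thetaBeta {q : ℂ} (hq : ‖q‖ < 1) {a b : ℂ} (hab : ‖a * b‖ < 1) :
    HasSum (fun n => shiftedProd a q n * shiftedProd b q n * thetaBeta q n)
      (∑' x, baileyTerm q a b x) := by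
  refine hasSum_of_eq (hasSum_antidiagonal (summable_baileyTerm hq hab)) (fun n => ?_) rfl
  rw [← thetaBeta_eq_sum hq n, Finset.mul_sum]
  refine Finset.sum_congr rfl fun x hx => ?_
  rw [baileyTerm, mem_antidiagonal.1 hx, thetaAlpha]

/-- The `q`-Gauss sum evaluates the rows of the double series. -/
theorem hasSum_baileyTerm_row {q : ℂ} (hq : ‖q‖ < 1) {a b : ℂ} (ha : ‖a * q ^ 2‖ < 1)
    (hb : ‖b * q ^ 2‖ < 1) (hab : ‖a * b‖ < 1) (r : ℕ) :
    HasSum (fun m => baileyTerm q a b (r, m))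
      (thetaAlpha q r * (shiftedProd a q r * shiftedProd b q r) /
          (qPoch (a * q ^ 2) (q ^ 2) r * qPoch (b * q ^ 2) (q ^ 2) r) *
        (qPochInf (a * q ^ 2) (q ^ 2) * qPochInf (b * q ^ 2) (q ^ 2) /
          (qPochInf (q ^ 2) (q ^ 2) * qPochInf (a * b) (q ^ 2)))) := by
  have hQ := norm_sq_lt_one hq
  have hu : ‖q ^ 2 * (q ^ 2) ^ r‖ < 1 := by
    rw [norm_mul]
    exact mul_lt_one_of_nonneg_of_lt_one_left (norm_nonneg _) hQ (norm_pow_le_one hQ r)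
  have hub : ‖q ^ 2 * (q ^ 2) ^ r * b‖ < 1 := by
    rw [show q ^ 2 * (q ^ 2) ^ r * b = b * q ^ 2 * (q ^ 2) ^ r by ring, norm_mul]
    exact mul_lt_one_of_nonneg_of_lt_one_left (norm_nonneg _) hb (norm_pow_le_one hQ r)
  have e1 : (q ^ 2 * (q ^ 2) ^ r) ^ 2 = q ^ 2 * (q ^ 2) ^ (2 * r + 1) := by ring
  have h := (hasSum_qGaussTerm hu hQ hab hub).mul_left (shiftedProd a q r * shiftedProd b q r *
    (thetaAlpha q r / qPoch (q ^ 2) (q ^ 2) (2 * r + 1)))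
  refine hasSum_of_eq h (fun m => ?_) ?_
  · rw [baileyTerm, qGaussTerm, e1, show m + 2 * r + 1 = 2 * r + 1 + m by ring, qPoch_add,
      shiftedProd_eq_qShift, shiftedProd_eq_qShift, shiftedProd_eq_qShift, shiftedProd_eq_qShift,
      qShift_add, qShift_add, div_mul_eq_div_div]
    ring
  · have n1 := qPoch_ne_zero ha hQ r
    have n2 := qPoch_ne_zero hb hQ r
    have n3 := qPoch_ne_zero hQ hQ (2 * r + 1)
    have n4 := qPochInf_ne_zero hab hQ
    have n5 : qPochInf (q ^ 2 * (q ^ 2) ^ (2 * r + 1)) (q ^ 2) ≠ 0 := by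
      rw [← e1]; exact qPochInf_ne_zero (norm_sq_lt_one hu) hQ
    rw [e1, qPochInf_eq_mul (a * q ^ 2) hQ r, qPochInf_eq_mul (b * q ^ 2) hQ r,
      qPochInf_eq_mul (q ^ 2) hQ (2 * r + 1),
      show q ^ 2 * (q ^ 2) ^ r * a = a * q ^ 2 * (q ^ 2) ^ r by ring,
      show q ^ 2 * (q ^ 2) ^ r * b = b * q ^ 2 * (q ^ 2) ^ r by ring]
    generalize a * q ^ 2 = x at n1 ⊢
    generalize b * q ^ 2 = y at n2 ⊢
    field_simp

/-- The two-parameter identity in its polynomial form. -/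
theorem hasSum_shiftedProd_theta {q : ℂ} (hq : ‖q‖ < 1) {a b : ℂ} (ha : ‖a * q ^ 2‖ < 1)
    (hb : ‖b * q ^ 2‖ < 1) (hab : ‖a * b‖ < 1) :
    HasSum (fun n : ℕ => (1 - q ^ (4 * n + 2)) * (shiftedProd a q n * shiftedProd b q n) /
        (qPoch (a * q ^ 2) (q ^ 2) n * qPoch (b * q ^ 2) (q ^ 2) n) *
          (q ^ (n * (n - 1)) * ∑ j ∈ Finset.Icc (-(n : ℤ)) (n : ℤ), q ^ j.natAbs ^ 2))
      (qPochInf (q ^ 2) (q ^ 2) * qPochInf (a * b) (q ^ 2) /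
          (qPochInf (a * q ^ 2) (q ^ 2) * qPochInf (b * q ^ 2) (q ^ 2)) *
        ∑' n, shiftedProd a q n * shiftedProd b q n * thetaBeta q n) := by
  have hQ := norm_sq_lt_one hq
  rw [(hasSum_thetaBeta hq hab).tsum_eq, mul_comm (_ / _)]
  have h := ((summable_baileyTerm hq hab).hasSum.prod_fiberwise
    (hasSum_baileyTerm_row hq ha hb hab)).mul_right (qPochInf (q ^ 2) (q ^ 2) *
      qPochInf (a * b) (q ^ 2) / (qPochInf (a * q ^ 2) (q ^ 2) * qPochInf (b * q ^ 2) (q ^ 2)))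
  refine hasSum_of_eq h (fun n => ?_) rfl
  have n1 := qPochInf_ne_zero ha hQ
  have n2 := qPochInf_ne_zero hb hQ
  have n3 := qPochInf_ne_zero hQ hQ
  have n4 := qPochInf_ne_zero hab hQ
  have e : q ^ (4 * n + 2) = (q ^ 2) ^ (2 * n + 1) := by ring
  rw [thetaAlpha, ← thetaTransform_eq hq, e]
  generalize a * q ^ 2 = x at n1 ⊢
  generalize b * q ^ 2 = y at n2 ⊢
  field_simp

/-! ### Specializations -/

theorem norm_lt_one_of_sq_eq {p q : ℂ} (hq : ‖q‖ < 1) (hpq : p ^ 2 = q ^ 2) : ‖p‖ < 1 := by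
  have h := norm_sq_lt_one hq
  rw [← hpq, norm_pow] at h
  exact (pow_lt_one_iff_of_nonneg (norm_nonneg p) two_ne_zero).1 h

theorem norm_mul_sq_lt_one {q x : ℂ} (hq : ‖q‖ < 1) (hx : ‖x‖ ≤ 1) : ‖x * q ^ 2‖ < 1 := by
  rw [norm_mul]
  exact mul_lt_one_of_nonneg_of_lt_one_right hx (norm_nonneg _) (norm_sq_lt_one hq)

theorem qShift_mul (a x p : ℂ) (n : ℕ) : qShift (a * x) p a n = a ^ n * qPoch x p n := by
  rw [qShift, qPoch, ← Finset.card_range n, ← Finset.prod_const, Finset.card_range,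
    ← Finset.prod_mul_distrib]
  exact Finset.prod_congr rfl fun k _ => by ring

/-- The two-parameter identity at `p = ± q`. Only the theta sum and `(p; q²)_n` depend on the
sign. -/
theorem hasSum_qShift_theta {p q : ℂ} (hq : ‖q‖ < 1) (hpq : p ^ 2 = q ^ 2) {a b : ℂ}
    (ha : ‖a‖ ≤ 1) (hb : ‖b‖ ≤ 1) (hab : ‖a * b‖ < 1) :
    Summable (fun n => qShift (q ^ 2) (q ^ 2) a n * qShift (q ^ 2) (q ^ 2) b n * thetaBeta p n) ∧
    HasSum (fun n : ℕ => (1 - (q ^ 2) ^ (2 * n + 1)) *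
        (qShift (q ^ 2) (q ^ 2) a n * qShift (q ^ 2) (q ^ 2) b n) /
        (qPoch (a * q ^ 2) (q ^ 2) n * qPoch (b * q ^ 2) (q ^ 2) n) *
          (q ^ (n * (n - 1)) * ∑ j ∈ Finset.Icc (-(n : ℤ)) (n : ℤ), p ^ j.natAbs ^ 2))
      (qPochInf (q ^ 2) (q ^ 2) * qPochInf (a * b) (q ^ 2) /
          (qPochInf (a * q ^ 2) (q ^ 2) * qPochInf (b * q ^ 2) (q ^ 2)) *
        ∑' n, qShift (q ^ 2) (q ^ 2) a n * qShift (q ^ 2) (q ^ 2) b n * thetaBeta p n) := by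
  have hp := norm_lt_one_of_sq_eq hq hpq
  have h1 := (hasSum_thetaBeta hp hab).summable
  have h2 := hasSum_shiftedProd_theta hp (norm_mul_sq_lt_one hp ha) (norm_mul_sq_lt_one hp hb) hab
  simp only [shiftedProd_eq_qShift, hpq] at h1 h2
  refine ⟨h1, hasSum_of_eq h2 (fun n => ?_) rfl⟩
  have e1 : p ^ (4 * n + 2) = (q ^ 2) ^ (2 * n + 1) := by rw [← hpq]; ring
  have e2 : p ^ (n * (n - 1)) = q ^ (n * (n - 1)) := by
    obtain ⟨m, hm⟩ := Nat.even_mul_pred_self n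
    rw [hm, ← two_mul, pow_mul, pow_mul, hpq]
  rw [e1, e2]

theorem summable_pow_mul {q : ℂ} (hq : ‖q‖ < 1) {e : ℕ → ℕ} (he : ∀ n, n ≤ e n) {c : ℕ → ℂ}
    (hc : ∀ n, ‖c n‖ ≤ 2 * n + 1) : Summable fun n => q ^ e n * c n := by
  have h1 := summable_pow_mul_geometric_of_norm_lt_one 1
    (show ‖‖q‖‖ < 1 by rwa [norm_norm])
  have h2 := summable_geometric_of_lt_one (norm_nonneg q) hq
  refine .of_norm_bounded ((h1.mul_left 2).add h2) fun n => ?_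
  rw [norm_mul, norm_pow]
  calc ‖q‖ ^ e n * ‖c n‖ ≤ ‖q‖ ^ n * (2 * n + 1) :=
        mul_le_mul (pow_le_pow_of_le_one (norm_nonneg q) hq.le (he n)) (hc n) (norm_nonneg _)
          (pow_nonneg (norm_nonneg q) n)
    _ = _ := by ring

/-- The truncated `n - 1` is harmless at `n = 0`, being multiplied by `n`. -/
theorem pow_sq_eq (q : ℂ) (n : ℕ) : q ^ n * q ^ (n * (n - 1)) = q ^ n ^ 2 := by
  cases n with
  | zero => simp
  | succ n => rw [Nat.add_sub_cancel]; ring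

/-- The case `(a, b) = (1, q)` at `p = ± q`. -/
theorem hasSum_theta_one {p q : ℂ} (hq : ‖q‖ < 1) (hpq : p ^ 2 = q ^ 2) :
    Summable (fun n : ℕ => q ^ (n + 1) * qPoch q (q ^ 2) (n + 1) /
      ((1 + q ^ (2 * (n + 1))) * qPoch p (q ^ 2) (n + 1))) ∧
    HasSum (fun n : ℕ => ∑ j ∈ Finset.Icc (-((n : ℤ) + 1) + 1) ((n : ℤ) + 1),
        q ^ (n + 1) ^ 2 * p ^ j.natAbs ^ 2)
      (∑' n : ℕ, q ^ (n + 1) * qPoch q (q ^ 2) (n + 1) /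
        ((1 + q ^ (2 * (n + 1))) * qPoch p (q ^ 2) (n + 1))) := by
  have hp := norm_lt_one_of_sq_eq hq hpq
  have hQ := norm_sq_lt_one hq
  set T : ℕ → ℂ := fun n => q ^ (n + 1) * qPoch q (q ^ 2) (n + 1) /
      ((1 + q ^ (2 * (n + 1))) * qPoch p (q ^ 2) (n + 1)) with hT
  obtain ⟨hs, h⟩ := hasSum_qShift_theta (a := 1) (b := q) hq hpq (by simp) hq.le (by simpa)
  set U : ℕ → ℂ := fun n =>
    qShift (q ^ 2) (q ^ 2) 1 n * qShift (q ^ 2) (q ^ 2) q n * thetaBeta p n with hU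
  have s1 : ∀ n, qShift (q ^ 2) (q ^ 2) 1 n = qPoch (q ^ 2) (q ^ 2) n := fun n => by
    simpa using qShift_mul 1 (q ^ 2) (q ^ 2) n
  have s2 : ∀ n, qShift (q ^ 2) (q ^ 2) q n = q ^ n * qPoch q (q ^ 2) n := fun n => by
    simpa [← sq] using qShift_mul q q (q ^ 2) n
  have hU0 : U 0 = 1 := by simp [hU, qShift, thetaBeta, qPoch]
  have hU1 : ∀ n, U (n + 1) = 2 * T n := fun n => by
    have hb := thetaBeta_mul hp (n + 1)
    rw [hpq] at hb
    have n1 := qPoch_ne_zero hQ hQ (n + 1)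
    have n2 := qPoch_ne_zero hp hQ (n + 1)
    have n3 := one_add_pow_ne_zero hq n
    rw [← eq_div_iff n3] at hb
    simp only [hU, hT, s1, s2, hb, pow_mul]
    generalize qPoch (q ^ 2) (q ^ 2) (n + 1) = x at n1 ⊢
    generalize 1 + (q ^ 2) ^ (n + 1) = y at n3 ⊢
    field_simp
  have hTs : Summable T := by
    refine (((summable_nat_add_iff 1).2 hs).mul_left (1 / 2)).congr fun n => ?_
    rw [hU1]; ring
  have hUT : ∑' n, U n = 1 + 2 * ∑' n, T n := by
    rw [hs.tsum_eq_zero_add, hU0]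
    simp only [hU1, tsum_mul_left]
  set S : ℕ → ℂ := fun n => ∑ j ∈ Finset.Icc (-(n : ℤ)) (n : ℤ), p ^ j.natAbs ^ 2 with hS
  have hSb : ∀ n, ‖S n‖ ≤ 2 * n + 1 :=
    norm_sum_Icc_le (f := fun j => p ^ j ^ 2) fun j => norm_pow_le_one hp _
  have hq1 : 1 - q ≠ 0 := by simpa using one_sub_mul_pow_ne_zero hq hQ 0
  -- dividing by `1 - q` leaves the coefficient `(1 + q^{2n+1}) q^{n²} = q^{n²} + q^{(n+1)²}`
  have hGY : HasSum (fun n => q ^ n ^ 2 * S n + q ^ (n + 1) ^ 2 * S n)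
      (1 + 2 * ∑' n, T n) := by
    rw [hUT] at h
    refine hasSum_of_eq (h.mul_left (1 - q)⁻¹) (fun n => ?_) ?_
    · have n1 := qPoch_ne_zero hQ hQ n
      have n2 := qPoch_ne_zero (norm_mul_sq_lt_one hq hq.le) hQ n
      have e := (qPoch_succ q (q ^ 2) n).symm.trans (qPoch_succ' q (q ^ 2) n)
      rw [s1, s2, one_mul, ← pow_sq_eq]
      rw [show (1 - (q ^ 2) ^ (2 * n + 1)) = (1 - q * (q ^ 2) ^ n) * (1 + q * (q ^ 2) ^ n) by ring,
        show q ^ (n + 1) ^ 2 = q ^ n ^ 2 * (q * (q ^ 2) ^ n) by ring, ← pow_sq_eq,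
        show (1 - q * (q ^ 2) ^ n) * (1 + q * (q ^ 2) ^ n) *
          (qPoch (q ^ 2) (q ^ 2) n * (q ^ n * qPoch q (q ^ 2) n)) =
          (1 + q * (q ^ 2) ^ n) * q ^ n * qPoch (q ^ 2) (q ^ 2) n *
            (qPoch q (q ^ 2) n * (1 - q * (q ^ 2) ^ n)) by ring, e]
      generalize qPoch (q ^ 2) (q ^ 2) n = x at n1 ⊢
      generalize qPoch (q * q ^ 2) (q ^ 2) n = y at n2 ⊢
      simp only [hS]
      field_simp
    · have n1 := qPochInf_ne_zero hQ hQ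
      have n2 := qPochInf_ne_zero (norm_mul_sq_lt_one hq hq.le) hQ
      have e := qPochInf_eq_mul q hQ 1
      rw [pow_one] at e
      rw [one_mul, one_mul, e]
      simp only [qPoch, Finset.range_one, Finset.prod_singleton, pow_zero, mul_one]
      generalize qPochInf (q ^ 2) (q ^ 2) = x at n1 ⊢
      generalize qPochInf (q * q ^ 2) (q ^ 2) = y at n2 ⊢
      field_simp
  have hG : Summable fun n => q ^ n ^ 2 * S n :=
    summable_pow_mul hq (fun n => Nat.le_self_pow two_ne_zero n) hSb
  have hY : Summable fun n => q ^ (n + 1) ^ 2 * S n :=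
    summable_pow_mul hq (fun n => n.le_succ.trans (Nat.le_self_pow two_ne_zero _)) hSb
  refine ⟨hTs, ?_⟩
  have hsum := hGY.unique (hG.hasSum.add hY.hasSum)
  have hG1 := ((summable_nat_add_iff 1).2 hG).hasSum
  have hG0 := hG.tsum_eq_zero_add
  simp only [hS, Nat.cast_zero, neg_zero, Finset.Icc_self, Finset.sum_singleton, Int.natAbs_zero,
    ne_eq, OfNat.ofNat_ne_zero, not_false_eq_true, zero_pow, pow_zero, mul_one] at hG0
  -- shifting the first half by one, `q^{(n+1)²}` gets the coefficient `S (n + 1) + S n`, which is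
  -- twice the sum over `-n ≤ j ≤ n + 1`
  refine hasSum_of_eq ((hG1.add hY.hasSum).mul_left (1 / 2)) (fun n => ?_) ?_
  · rw [← Finset.mul_sum, sum_Icc_natAbs_succ_half (fun j => p ^ j ^ 2)]
    simp only [hS]
    rw [sum_Icc_natAbs_succ (fun j => p ^ j ^ 2)]
    ring
  · simp only [hS] at hsum
    linear_combination (1 / 2) * hsum + (1 / 2) * hG0

/-- The case `(a, b) = (-1, -q)` at `p = ± q`. -/
theorem tsum_theta_neg_one {p q : ℂ} (hq : ‖q‖ < 1) (hpq : p ^ 2 = q ^ 2) :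
    Summable (fun n : ℕ => qPoch (-1) (q ^ 2) n * qPoch (-q) (q ^ 2) n * q ^ n /
      (qPoch (q ^ 2) (q ^ 2) n * qPoch p (q ^ 2) n)) ∧
    Summable (fun n : ℕ => ∑ j ∈ Finset.Icc (-(n : ℤ)) (n : ℤ),
      (1 - q ^ (2 * n + 1)) * q ^ n ^ 2 * p ^ j.natAbs ^ 2) ∧
    ∑' n : ℕ, qPoch (-1) (q ^ 2) n * qPoch (-q) (q ^ 2) n * q ^ n /
      (qPoch (q ^ 2) (q ^ 2) n * qPoch p (q ^ 2) n) =
      qPochInf (-q) q / qPochInf q q * ∑' n : ℕ, ∑ j ∈ Finset.Icc (-(n : ℤ)) (n : ℤ),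
        (1 - q ^ (2 * n + 1)) * q ^ n ^ 2 * p ^ j.natAbs ^ 2 := by
  have hp := norm_lt_one_of_sq_eq hq hpq
  have hQ := norm_sq_lt_one hq
  have hnQ := norm_neg_sq_lt_one hq
  have hnq : ‖-q‖ < 1 := by rwa [norm_neg]
  obtain ⟨hs, h⟩ := hasSum_qShift_theta (a := -1) (b := -q) hq hpq (by simp) hnq.le (by simpa)
  have s1 : ∀ n, qShift (q ^ 2) (q ^ 2) (-1) n = (-1) ^ n * qPoch (-q ^ 2) (q ^ 2) n := fun n => by
    simpa using qShift_mul (-1) (-q ^ 2) (q ^ 2) n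
  have s2 : ∀ n, qShift (q ^ 2) (q ^ 2) (-q) n = (-q) ^ n * qPoch (-q) (q ^ 2) n := fun n => by
    simpa [← sq] using qShift_mul (-q) (-q) (q ^ 2) n
  have hsign : ∀ n, (-1 : ℂ) ^ n * (-q) ^ n = q ^ n := fun n => by
    rw [← mul_pow, neg_one_mul, neg_neg]
  have hV : ∀ n, qShift (q ^ 2) (q ^ 2) (-1) n * qShift (q ^ 2) (q ^ 2) (-q) n * thetaBeta p n =
      qPoch (-1) (q ^ 2) n * qPoch (-q) (q ^ 2) n * q ^ n /
        (qPoch (q ^ 2) (q ^ 2) n * qPoch p (q ^ 2) n) := fun n => by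
    have n1 := qPoch_ne_zero hnQ hQ n
    rw [s1, s2, thetaBeta, hpq, ← hsign n]
    generalize qPoch (-q ^ 2) (q ^ 2) n = x at n1 ⊢
    generalize (-1 : ℂ) ^ n = ε
    field_simp
  simp only [hV] at hs h
  rw [show (-1 : ℂ) * -q = q by ring, neg_one_mul] at h
  have hq1 : 1 + q ≠ 0 := by simpa using one_sub_mul_pow_ne_zero hnq hQ 0
  have m1 := qPochInf_ne_zero hQ hQ
  have m2 := qPochInf_ne_zero hq hQ
  have m3 := qPochInf_ne_zero hnQ hQ
  have m4 := qPochInf_ne_zero (norm_mul_sq_lt_one hq hnq.le) hQ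
  have h' : HasSum (fun n : ℕ => ∑ j ∈ Finset.Icc (-(n : ℤ)) (n : ℤ),
      (1 - q ^ (2 * n + 1)) * q ^ n ^ 2 * p ^ j.natAbs ^ 2) _ :=
    hasSum_of_eq (h.mul_left (1 + q)⁻¹) (fun n => by
      have n1 := qPoch_ne_zero hnQ hQ n
      have n2 := qPoch_ne_zero (norm_mul_sq_lt_one hq hnq.le) hQ n
      have e := (qPoch_succ (-q) (q ^ 2) n).symm.trans (qPoch_succ' (-q) (q ^ 2) n)
      rw [← Finset.mul_sum, s1, s2, ← pow_sq_eq, ← hsign n,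
        pow_succ q, pow_mul,
        show (1 - (q ^ 2) ^ (2 * n + 1)) =
          (1 - (q ^ 2) ^ n * q) * (1 - -q * (q ^ 2) ^ n) by ring,
        show (1 - (q ^ 2) ^ n * q) * (1 - -q * (q ^ 2) ^ n) *
          ((-1) ^ n * qPoch (-q ^ 2) (q ^ 2) n * ((-q) ^ n * qPoch (-q) (q ^ 2) n)) =
          (1 - (q ^ 2) ^ n * q) * (-1) ^ n * (-q) ^ n * qPoch (-q ^ 2) (q ^ 2) n *
            (qPoch (-q) (q ^ 2) n * (1 - -q * (q ^ 2) ^ n)) by ring, e, sub_neg_eq_add]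
      generalize qPoch (-q ^ 2) (q ^ 2) n = x at n1 ⊢
      generalize qPoch (-q * q ^ 2) (q ^ 2) n = y at n2 ⊢
      generalize (-1 : ℂ) ^ n = ε
      field_simp) rfl
  refine ⟨hs, h'.summable, ?_⟩
  have e := qPochInf_eq_mul (-q) hQ 1
  rw [pow_one] at e
  simp only [qPoch, Finset.range_one, Finset.prod_singleton, pow_zero, mul_one,
    sub_neg_eq_add] at e
  rw [h'.tsum_eq, qPochInf_eq_mul_sq q hq, qPochInf_eq_mul_sq (-q) hq, e, neg_mul q q, ← sq]
  generalize qPochInf (-q ^ 2) (q ^ 2) = x at m3 ⊢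
  generalize qPochInf (-q * q ^ 2) (q ^ 2) = y at m4 ⊢
  generalize qPochInf (q ^ 2) (q ^ 2) = z at m1 ⊢
  generalize qPochInf q (q ^ 2) = w at m2 ⊢
  field_simp

theorem neg_pow_sq (q : ℂ) (j : ℕ) : (-q) ^ j ^ 2 = (-1) ^ j * q ^ j ^ 2 := by
  rw [neg_pow]
  congr 1
  rcases Nat.even_or_odd j with h | h
  · rw [h.neg_one_pow, (h.pow_of_ne_zero two_ne_zero).neg_one_pow]
  · rw [h.neg_one_pow, h.pow.neg_one_pow]

theorem theorem3p1 (q : ℂ) (hq : ‖q‖ < 1) :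
    -- the `(a, b)`-parameterized identity
    (∀ a b : ℂ, a ≠ 0 → b ≠ 0 → max (max ‖a * q ^ 2‖ ‖b * q ^ 2‖) ‖a * b‖ < 1 →
      Summable (basicHypergeometricTerm
        [q ^ 2 / a, q ^ 2 / b, -1] [q, -q ^ 2] (q ^ 2) (a * b)) ∧
      HasSum
        (fun n : ℕ => ∑ j ∈ Finset.Icc (-(n : ℤ)) (n : ℤ),
          (1 - q ^ (4 * n + 2)) * qPochs [q ^ 2 / a, q ^ 2 / b] (q ^ 2) n * (a * b) ^ n /
            qPochs [a * q ^ 2, b * q ^ 2] (q ^ 2) n * q ^ (n * (n - 1) + j.natAbs ^ 2))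
        (qPochsInf [q ^ 2, a * b] (q ^ 2) / qPochsInf [a * q ^ 2, b * q ^ 2] (q ^ 2) *
          basicHypergeometric [q ^ 2 / a, q ^ 2 / b, -1] [q, -q ^ 2] (q ^ 2) (a * b))) ∧
    -- the same identity with `a = 0` or `b = 0` allowed, in the limiting form
    (∀ a b : ℂ, max (max ‖a * q ^ 2‖ ‖b * q ^ 2‖) ‖a * b‖ < 1 →
      Summable (fun n : ℕ => shiftedProd a q n * shiftedProd b q n * qPoch (-1) (q ^ 2) n /
        qPochs [q ^ 2, q, -q ^ 2] (q ^ 2) n) ∧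
      HasSum
        (fun n : ℕ => ∑ j ∈ Finset.Icc (-(n : ℤ)) (n : ℤ),
          (1 - q ^ (4 * n + 2)) * (shiftedProd a q n * shiftedProd b q n) /
            qPochs [a * q ^ 2, b * q ^ 2] (q ^ 2) n * q ^ (n * (n - 1) + j.natAbs ^ 2))
        (qPochsInf [q ^ 2, a * b] (q ^ 2) / qPochsInf [a * q ^ 2, b * q ^ 2] (q ^ 2) *
          ∑' n : ℕ, shiftedProd a q n * shiftedProd b q n * qPoch (-1) (q ^ 2) n /
            qPochs [q ^ 2, q, -q ^ 2] (q ^ 2) n)) ∧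
    -- `(a, b) = (1, q)`; the sums over `n ≥ 1` are indexed by `n + 1`
    (Summable (fun n : ℕ => q ^ (n + 1) / (1 + q ^ (2 * (n + 1)))) ∧
      HasSum
        (fun n : ℕ => ∑ j ∈ Finset.Icc (-((n : ℤ) + 1) + 1) ((n : ℤ) + 1),
          q ^ ((n + 1) ^ 2 + j.natAbs ^ 2))
        (∑' n : ℕ, q ^ (n + 1) / (1 + q ^ (2 * (n + 1))))) ∧
    -- `(a, b) = (1, -q)`, then `q ↦ -q`: the identity of Wang and Yee
    (Summable (fun n : ℕ => q ^ (n + 1) * qPoch q (q ^ 2) (n + 1) /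
        ((1 + q ^ (2 * (n + 1))) * qPoch (-q) (q ^ 2) (n + 1))) ∧
      HasSum
        (fun n : ℕ => ∑ j ∈ Finset.Icc (-(n : ℤ) + 1) (n : ℤ),
          (-1) ^ j.natAbs * q ^ (n ^ 2 + j.natAbs ^ 2))
        (∑' n : ℕ, q ^ (n + 1) * qPoch q (q ^ 2) (n + 1) /
          ((1 + q ^ (2 * (n + 1))) * qPoch (-q) (q ^ 2) (n + 1)))) ∧
    -- `(a, b) = (-1, q)`, then `q ↦ -q`
    (Summable (fun n : ℕ => qPoch (-1) (q ^ 2) n * q ^ n / qPoch (q ^ 2) (q ^ 2) n) ∧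
      Summable (fun n : ℕ => ∑ j ∈ Finset.Icc (-(n : ℤ)) (n : ℤ),
        (-1) ^ j.natAbs * (1 - q ^ (2 * n + 1)) * q ^ (n ^ 2 + j.natAbs ^ 2)) ∧
      ∑' n : ℕ, qPoch (-1) (q ^ 2) n * q ^ n / qPoch (q ^ 2) (q ^ 2) n =
        qPochInf (-q) q / qPochInf q q *
          ∑' n : ℕ, ∑ j ∈ Finset.Icc (-(n : ℤ)) (n : ℤ),
            (-1) ^ j.natAbs * (1 - q ^ (2 * n + 1)) * q ^ (n ^ 2 + j.natAbs ^ 2)) ∧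
    -- `(a, b) = (-1, -q)`
    (Summable (fun n : ℕ => qPoch (-1) q (2 * n) * q ^ n / qPoch q q (2 * n)) ∧
      Summable (fun n : ℕ => ∑ j ∈ Finset.Icc (-(n : ℤ)) (n : ℤ),
        (1 - q ^ (2 * n + 1)) * q ^ (n ^ 2 + j.natAbs ^ 2)) ∧
      ∑' n : ℕ, qPoch (-1) q (2 * n) * q ^ n / qPoch q q (2 * n) =
        qPochInf (-q) q / qPochInf q q *
          ∑' n : ℕ, ∑ j ∈ Finset.Icc (-(n : ℤ)) (n : ℤ),
            (1 - q ^ (2 * n + 1)) * q ^ (n ^ 2 + j.natAbs ^ 2)) := by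
  have hQ := norm_sq_lt_one hq
  have hpart : ∀ a b : ℂ, max (max ‖a * q ^ 2‖ ‖b * q ^ 2‖) ‖a * b‖ < 1 →
      Summable (fun n : ℕ => shiftedProd a q n * shiftedProd b q n * qPoch (-1) (q ^ 2) n /
        qPochs [q ^ 2, q, -q ^ 2] (q ^ 2) n) ∧
      HasSum
        (fun n : ℕ => ∑ j ∈ Finset.Icc (-(n : ℤ)) (n : ℤ),
          (1 - q ^ (4 * n + 2)) * (shiftedProd a q n * shiftedProd b q n) /
            qPochs [a * q ^ 2, b * q ^ 2] (q ^ 2) n * q ^ (n * (n - 1) + j.natAbs ^ 2))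
        (qPochsInf [q ^ 2, a * b] (q ^ 2) / qPochsInf [a * q ^ 2, b * q ^ 2] (q ^ 2) *
          ∑' n : ℕ, shiftedProd a q n * shiftedProd b q n * qPoch (-1) (q ^ 2) n /
            qPochs [q ^ 2, q, -q ^ 2] (q ^ 2) n) := by
    intro a b hab
    obtain ⟨h1, hab⟩ := max_lt_iff.1 hab
    obtain ⟨ha, hb⟩ := max_lt_iff.1 h1
    have e : ∀ n, shiftedProd a q n * shiftedProd b q n * qPoch (-1) (q ^ 2) n /
        qPochs [q ^ 2, q, -q ^ 2] (q ^ 2) n =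
        shiftedProd a q n * shiftedProd b q n * thetaBeta q n := fun n => by
      simp [qPochs, thetaBeta, mul_div_assoc, mul_assoc]
    simp only [e]
    refine ⟨(hasSum_thetaBeta hq hab).summable,
      hasSum_of_eq (hasSum_shiftedProd_theta hq ha hb hab) (fun n => ?_) ?_⟩
    · simp only [qPochs, pow_add, Finset.mul_sum, List.map_cons, List.map_nil, List.prod_cons,
        List.prod_nil, mul_one]
    · simp [qPochsInf]
  refine ⟨fun a b ha hb hab => ?_, hpart, ?_, ?_, ?_, ?_⟩
  · obtain ⟨h1, h2⟩ := hpart a b hab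
    have e : ∀ n, basicHypergeometricTerm [q ^ 2 / a, q ^ 2 / b, -1] [q, -q ^ 2] (q ^ 2) (a * b) n =
        shiftedProd a q n * shiftedProd b q n * qPoch (-1) (q ^ 2) n /
          qPochs [q ^ 2, q, -q ^ 2] (q ^ 2) n := fun n => by
      rw [shiftedProd_eq a q ha, shiftedProd_eq b q hb]
      simp [basicHypergeometricTerm, qPochs, mul_pow]
      ring
    rw [basicHypergeometric, funext e]
    refine ⟨h1, hasSum_of_eq h2 (fun n => ?_) rfl⟩
    rw [shiftedProd_eq a q ha, shiftedProd_eq b q hb]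
    refine Finset.sum_congr rfl fun j _ => ?_
    simp only [qPochs, mul_pow, List.map_cons, List.map_nil, List.prod_cons, List.prod_nil]
    ring
  · have h := hasSum_theta_one hq (p := q) rfl
    have e : ∀ n : ℕ, q ^ (n + 1) * qPoch q (q ^ 2) (n + 1) /
        ((1 + q ^ (2 * (n + 1))) * qPoch q (q ^ 2) (n + 1)) =
        q ^ (n + 1) / (1 + q ^ (2 * (n + 1))) := fun n =>
      mul_div_mul_right _ _ (qPoch_ne_zero hq hQ _)
    simpa only [e, ← pow_add] using h
  · have h := hasSum_theta_one hq (p := -q) (by ring)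
    -- the sum over `j` is empty for `n = 0`
    refine ⟨h.1, (hasSum_nat_add_iff' 1).1 ?_⟩
    refine hasSum_of_eq h.2 (fun n => ?_) (by simp)
    rw [Nat.cast_add, Nat.cast_one]
    refine Finset.sum_congr rfl fun j _ => ?_
    rw [neg_pow_sq, pow_add]
    ring
  · obtain ⟨h1, h2, h3⟩ := tsum_theta_neg_one hq (p := -q) (by ring)
    have hnq : ‖-q‖ < 1 := by rwa [norm_neg]
    have e1 : ∀ n : ℕ, qPoch (-1) (q ^ 2) n * qPoch (-q) (q ^ 2) n * q ^ n /
        (qPoch (q ^ 2) (q ^ 2) n * qPoch (-q) (q ^ 2) n) =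
        qPoch (-1) (q ^ 2) n * q ^ n / qPoch (q ^ 2) (q ^ 2) n := fun n => by
      rw [mul_right_comm, mul_div_mul_right _ _ (qPoch_ne_zero hnq hQ _)]
    have e2 : ∀ (n : ℕ) (j : ℤ), (1 - q ^ (2 * n + 1)) * q ^ n ^ 2 * (-q) ^ j.natAbs ^ 2 =
        (-1) ^ j.natAbs * (1 - q ^ (2 * n + 1)) * q ^ (n ^ 2 + j.natAbs ^ 2) := fun n j => by
      rw [neg_pow_sq, pow_add]
      ring
    simp only [e1, e2] at h1 h2 h3
    exact ⟨h1, h2, h3⟩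
  · obtain ⟨h1, h2, h3⟩ := tsum_theta_neg_one hq (p := q) rfl
    have e1 : ∀ n : ℕ, qPoch (-1) (q ^ 2) n * qPoch (-q) (q ^ 2) n * q ^ n /
        (qPoch (q ^ 2) (q ^ 2) n * qPoch q (q ^ 2) n) =
        qPoch (-1) q (2 * n) * q ^ n / qPoch q q (2 * n) := fun n => by
      rw [qPoch_two_mul, qPoch_two_mul, neg_one_mul, ← sq, mul_comm (qPoch q _ _)]
    have e2 : ∀ (n : ℕ) (j : ℤ), (1 - q ^ (2 * n + 1)) * q ^ n ^ 2 * q ^ j.natAbs ^ 2 =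
        (1 - q ^ (2 * n + 1)) * q ^ (n ^ 2 + j.natAbs ^ 2) := fun n j => by
      rw [mul_assoc, ← pow_add]
    simp only [e1, e2] at h1 h2 h3
    exact ⟨h1, h2, h3⟩
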